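/- Let $\Sigma=\{a,b\}$ and let $\Sigma^*$ be the set of finite words over $\Sigma$; a factor of a word $w$ is a word $z$ with $w=uzv$ for some $u,v\in\Sigma^*$, and $|w|_a$ is the number of occurrences of $a$ in $w$. A word $w\in\Sigma^*$ is Sturmian if it is balanced, i.e. $\bigl||u|_a-|v|_a\bigr|\le 1$ for any two factors $u,v$ of $w$ of the same length; let $\mathit{St}$ be the language of Sturmian words. A minimal forbidden word for a language $L$ is a word that is not in $L$ but all of whose proper factors are in $L$; let $\mathit{MF}_{\mathit{St}}$ be the set of minimal forbidden words for $\mathit{St}$. For integers $p,q>0$ and $n=p+q$, the lower Christoffel word $w_{p,q}$ is the word of length $n$ whose $i$-th letter ($1\le i\le n$) is $a$ if $(iq \bmod n)>((i-1)q \bmod n)$ and $b$ if $(iq \bmod n)<((i-1)q \bmod n)$; the upper Christoffel word $w'_{p,q}$ is the word of length $n$ whose $i$-th letter is $a$ if $(ip \bmod n)<((i-1)p \bmod n)$ and $b$ if $(ip \bmod n)>((i-1)p \bmod n)$. A Christoffel word is a lower or an upper Christoffel word ($p$ and $q$ need not be coprime). A word is primitive if it is not the concatenation of two or more copies of some word.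 Theorem. The minimal forbidden words for $\mathit{St}$ are exactly the words $ywx$ such that $xwy$ is a non-primitive Christoffel word, where $\{x,y\}=\{a,b\}$: $$\mathit{MF}_{\mathit{St}}=\{\,ywx \mid w\in\Sigma^*,\ \{x,y\}=\{a,b\},\ xwy \text{ is a non-primitive Christoffel word}\,\}.$$ -/

import Mathlib

namespace SturmianWords

/-- The binary alphabet `{a, b}`. -/
inductive Letter where
  | a : Letter
  | b : Letter
  deriving DecidableEq

/-- Finite words over `{a, b}`; `u <:+: w` says that `u` is a factor of `w`. -/
abbrev Word := List Letter

/-- A word is balanced if any two of its factors of the same length have numbers of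
occurrences of the letter `a` that differ by at most one. -/
def IsBalanced (w : Word) : Prop :=
  ∀ u v : Word, u <:+: w → v <:+: w → u.length = v.length →
    |(u.count Letter.a : ℤ) - (v.count Letter.a : ℤ)| ≤ 1

/-- The language `St` of finite Sturmian words, that is, of balanced words. -/
def sturmianLanguage : Language Letter :=
  {w : Word | IsBalanced w}

/-- The set of minimal forbidden words of a language `L`: the words that are not in `L`
although all their proper factors are. -/
def minimalForbiddenWords {α : Type*} (L : Language α) : Language α :=
  {v : List α | v ∉ L ∧ ∀ u : List α, u <:+: v → u ≠ v → u ∈ L}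

/-- A word is a power if it is the concatenation of at least two copies of some word. -/
def IsPower {α : Type*} (w : List α) : Prop :=
  ∃ (u : List α) (k : ℕ), 2 ≤ k ∧ w = (List.replicate k u).flatten

/-- A word is primitive if it is not a power. -/
def IsPrimitive {α : Type*} (w : List α) : Prop :=
  ¬ IsPower w

/-- The lower Christoffel word `w_{p,q}`, of length `n = p + q`. The index `i` starts at `0`, and
for `p, q > 0` consecutive multiples of `q` are distinct modulo `n`, so that "not `>`" means `<`. -/
def lowerChristoffel (p q : ℕ) : Word :=
  List.ofFn fun i : Fin (p + q) =>
    if ((i : ℕ) + 1) * q % (p + q) > (i : ℕ) * q % (p + q) then Letter.a else Letter.b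

/-- The upper Christoffel word `w'_{p,q}`, of length `n = p + q`; indices as for the lower one. -/
def upperChristoffel (p q : ℕ) : Word :=
  List.ofFn fun i : Fin (p + q) =>
    if ((i : ℕ) + 1) * p % (p + q) < (i : ℕ) * p % (p + q) then Letter.a else Letter.b

/-- Christoffel words, lower or upper, for positive `p` and `q` (not necessarily coprime). -/
def IsChristoffel (w : Word) : Prop :=
  ∃ p q : ℕ, 0 < p ∧ 0 < q ∧ (w = lowerChristoffel p q ∨ w = upperChristoffel p q)

end SturmianWords

namespace SturmianWords

/-! Encode a word of length n by its prefix counts P of the letter b: factors become increments of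
P, and deleting an end letter shrinks the interval on which P must be balanced. Minimality forces
the two clashing windows to be a prefix and a suffix of a common length k; exchanging letters if
needed, let the prefix have more b's.

The interior windows of length k are then squeezed to a single increment, and so are those of length
n - k. Hence P - 1, reset to 0 at 0 and continued by P(n) per period n, is additive along k and n,
so along d = gcd(k, n), a proper divisor of n; balance makes it ⌊ic/d⌋
(`floor_of_minimally_unbalanced`). Turning bwa into awb lowers the interior counts by one, which
leaves the counts of a lower Christoffel word whose parameters share the factor n/d ≥ 2: a power.

Conversely (`minimally_unbalanced_of_floor`), the raised counts clash on the prefix and suffix of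
length d, yet without either end letter they round down a slightly tilted line. -/

/-! ### Balance and rounded lines for integer functions -/

/-- The increments of `P` over windows of equal length inside `[s, e]` differ by at most one. -/
def BalancedOn (P : ℕ → ℤ) (s e : ℕ) : Prop :=
  ∀ i j m : ℕ, s ≤ i → s ≤ j → i + m ≤ e → j + m ≤ e →
    P (i + m) - P i ≤ P (j + m) - P j + 1

/-- A function that rounds down an affine function is balanced. -/
theorem balancedOn_of_line {P : ℕ → ℤ} {s e : ℕ} {N A R : ℤ} (hN : 0 < N)
    (h : ∀ i, s ≤ i → i ≤ e → N * P i ≤ A * i + R ∧ A * i + R < N * P i + N) :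
    BalancedOn P s e := by
  intro i j m hi hj hie hje
  obtain ⟨h1, h2⟩ := h i hi (by omega)
  obtain ⟨h3, h4⟩ := h j hj (by omega)
  obtain ⟨h5, h6⟩ := h (i + m) (by omega) hie
  obtain ⟨h7, h8⟩ := h (j + m) (by omega) hje
  push_cast at *
  have : N * (P (i + m) - P i) < N * (P (j + m) - P j + 2) := by linarith
  have := lt_of_mul_lt_mul_left this hN.le
  omega

/-- A function additive along two steps is additive along their greatest common divisor. -/
theorem add_gcd_of_add {G : ℕ → ℤ} {n k : ℕ} {q c : ℤ} (hk : 0 < k) (hkn : k < n)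
    (hn : ∀ i, G (i + n) = G i + q) (hc : ∀ i, G (i + k) = G i + c) :
    ∃ e : ℤ, ∀ i, G (i + k.gcd n) = G i + e := by
  have mul_step : ∀ {s : ℕ} {r : ℤ}, (∀ i, G (i + s) = G i + r) →
      ∀ t i : ℕ, G (i + s * t) = G i + t * r := by
    intro s r h t
    induction t with
    | zero => simp
    | succ t ih => intro i; rw [mul_add_one, ← add_assoc, h, ih]; push_cast; ring
  -- Bézout: m steps of length k amount to one step of length gcd(k, n) plus whole periods n.
  obtain ⟨m, hm⟩ := Nat.exists_mul_mod_eq_gcd (n := k) (k := n)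
    (lt_of_le_of_lt (Nat.gcd_le_left n hk) hkn)
  refine ⟨m * c - (k * m / n : ℕ) * q, fun i => ?_⟩
  have h1 := mul_step hc m i
  have h2 := mul_step hn (k * m / n) (i + k.gcd n)
  have h3 : i + k.gcd n + n * (k * m / n) = i + k * m := by
    have := Nat.mod_add_div (k * m) n
    omega
  rw [h3] at h2
  linarith

/-- A function of step `d` that is additive up to an error in `[0, 1]` rounds down a linear
function. -/
theorem floor_of_almost_additive {G : ℕ → ℤ} {d : ℕ} {c : ℤ} (hd : 0 < d) (h0 : G 0 = 0)
    (hc : ∀ i, G (i + d) = G i + c)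
    (h1 : ∀ i m, m < d → G i + G m ≤ G (i + m))
    (h2 : ∀ i m, m < d → G (i + m) ≤ G i + G m + 1) (i : ℕ) :
    d * G i ≤ i * c ∧ i * c < d * G i + d := by
  have hmul : ∀ t i : ℕ, G (i + d * t) = G i + t * c := by
    intro t
    induction t with
    | zero => simp
    | succ t ih => intro i; rw [mul_add_one, ← add_assoc, hc, ih]; push_cast; ring
  -- Iterating the error bounds d times gives d G(m) ≤ G(dm) ≤ d G(m) + d - 1, and G(dm) = mc.
  have key : ∀ m, m < d → d * G m ≤ m * c ∧ m * c < d * G m + d := by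
    intro m hm
    have lo : ∀ j : ℕ, j * G m ≤ G (j * m) := by
      intro j
      induction j with
      | zero => simp [h0]
      | succ j ih =>
        have := h1 (j * m) m hm
        rw [add_one_mul]; push_cast; linarith
    have hi : ∀ j : ℕ, G ((j + 1) * m) ≤ (j + 1) * G m + j := by
      intro j
      induction j with
      | zero => simp
      | succ j ih =>
        have := h2 ((j + 1) * m) m hm
        rw [add_one_mul (j + 1)]; push_cast; linarith
    have hG : G (d * m) = m * c := by
      have := hmul m 0
      simpa [h0] using this
    have a := lo d
    obtain ⟨e, rfl⟩ : ∃ e, d = e + 1 := ⟨d - 1, by omega⟩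
    have b := hi e
    rw [hG] at a b
    push_cast at *
    exact ⟨a, by linarith⟩
  have hi := Nat.mod_add_div i d
  obtain ⟨a, b⟩ := key (i % d) (Nat.mod_lt _ hd)
  have e := hmul (i / d) (i % d)
  rw [hi] at e
  have hi' : (i : ℤ) = (i % d : ℕ) + d * (i / d : ℕ) := by exact_mod_cast hi.symm
  rw [e, hi']
  constructor <;> linarith

/-! ### Minimally unbalanced prefix counts -/

/-- Prefix counts that are minimally unbalanced, with the prefix the heavier side, are shifted
roundings of a line whose slope has a denominator that properly divides the length. -/
theorem floor_of_minimally_unbalanced {P : ℕ → ℤ} {n k : ℕ} (h0 : P 0 = 0)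
    (hP : ∀ i, i < n → P i ≤ P (i + 1) ∧ P (i + 1) ≤ P i + 1)
    (hr : BalancedOn P 1 n) (hl : BalancedOn P 0 (n - 1)) (hk : 0 < k) (hkn : k < n)
    (h : 2 ≤ P k - (P n - P (n - k))) :
    ∃ (d g : ℕ) (c : ℤ), 0 < d ∧ 2 ≤ g ∧ n = g * d ∧ P n = g * c ∧
      ∀ i : ℕ, 0 < i → i < n → d * (P i - 1) ≤ i * c ∧ i * c < d * (P i - 1) + d := by
  -- For k = n - 1 or k = 1 the clash reduces to comparing two single letters, so it cannot reach 2.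
  -- Excluding both leaves interior windows of lengths k and n - k.
  have hk1 : k + 1 < n := by
    rcases Nat.lt_or_ge (k + 1) n with h' | h'
    · exact h'
    obtain rfl : n = k + 1 := by omega
    have a := hP 0 (by omega)
    have b := hP k (by omega)
    rw [Nat.add_sub_cancel_left] at h
    simp only [zero_add] at a
    omega
  have hk2 : 1 < k := by
    by_contra h'
    obtain rfl : k = 1 := by omega
    have a := hP 0 (by omega)
    have b := hP (n - 1) (by omega)
    rw [Nat.sub_add_cancel (by omega)] at b
    simp only [zero_add] at a
    omega
  have shift : ∀ k, 0 < k → k + 1 < n → 2 ≤ P k - (P n - P (n - k)) →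
      P k + P (n - k) = P n + 2 ∧ ∀ i, 0 < i → i + k < n → P (i + k) = P i + P k - 1 := by
    intro k hk hk1 h
    -- An interior window compares with the prefix through `hl` and with the suffix through `hr`; as
    -- these differ by at least 2, both bounds are equalities.
    have main : ∀ i, 0 < i → i + k < n → P k - 1 ≤ P (i + k) - P i ∧
        P (i + k) - P i ≤ P n - P (n - k) + 1 := by
      intro i hi hik
      have a := hl 0 i k le_rfl (by omega) (by omega) (by omega)
      have b := hr i (n - k) k (by omega) (by omega) (by omega) (by omega)
      rw [Nat.sub_add_cancel (by omega)] at b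
      rw [zero_add] at a
      omega
    have := main 1 one_pos (by omega)
    refine ⟨by omega, fun i hi hik => ?_⟩
    have := main i hi hik
    omega
  obtain ⟨e1, s1⟩ := shift k hk hk1 h
  obtain ⟨-, s2⟩ := shift (n - k) (by omega) (by omega)
    (by rw [Nat.sub_sub_self hkn.le]; omega)
  set G : ℕ → ℤ := fun i => (if i % n = 0 then 0 else P (i % n) - 1) + P n * (i / n : ℕ) with hG
  have hGs : ∀ i, 0 < i → i < n → G i = P i - 1 := by
    intro i hi hin
    simp only [hG, Nat.mod_eq_of_lt hin, Nat.div_eq_of_lt hin]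
    simp [hi.ne']
  have hG0 : G 0 = 0 := by simp [hG]
  have hGn : ∀ i, G (i + n) = G i + P n := by
    intro i
    simp only [hG, Nat.add_mod_right, Nat.add_div_right i (show 0 < n by omega)]
    push_cast; ring
  have hGmul : ∀ t i, G (i + n * t) = G i + t * P n := by
    intro t
    induction t with
    | zero => simp
    | succ t ih => intro i; rw [mul_add_one, ← add_assoc, hGn, ih]; push_cast; ring
  -- The sum r + k falls before n (`s1`), at n (`e1`), or past n, where the window of length n - k
  -- is used (`s2` with `e1`).
  have hGk' : ∀ r, r < n → G (r + k) = G r + (P k - 1) := by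
    intro r hrn
    rcases Nat.eq_zero_or_pos r with rfl | hr0
    · rw [zero_add, hGs k hk hkn, hG0, zero_add]
    rcases lt_trichotomy (r + k) n with h' | h' | h'
    · rw [hGs _ (by omega) h', hGs _ hr0 hrn, s1 r hr0 h']; ring
    · have := hGn 0
      rw [zero_add, hG0] at this
      rw [h', this, hGs _ hr0 hrn, show r = n - k by omega]; linarith
    · obtain ⟨t, rfl⟩ : ∃ t, r = t + (n - k) := ⟨r - (n - k), by omega⟩
      rw [show t + (n - k) + k = t + n by omega, hGn, hGs _ (by omega) (by omega),
        hGs _ hr0 hrn, s2 t (by omega) hrn]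
      linarith
  have hGk : ∀ i, G (i + k) = G i + (P k - 1) := by
    intro i
    have hi := Nat.mod_add_div i n
    have a := hGk' (i % n) (Nat.mod_lt _ (by omega))
    have b := hGmul (i / n) (i % n + k)
    have c := hGmul (i / n) (i % n)
    rw [hi] at c
    rw [show i % n + k + n * (i / n) = i + k by omega] at b
    linarith
  obtain ⟨c, hc⟩ := add_gcd_of_add hk hkn hGn hGk
  obtain ⟨g, hg⟩ := Nat.gcd_dvd_right k n
  have hdk : k.gcd n ≤ k := Nat.gcd_le_left n hk
  have hd0 : 0 < k.gcd n := Nat.gcd_pos_of_pos_left n hk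
  generalize k.gcd n = d at *
  have hg2 : 2 ≤ g := by
    by_contra h'
    have : g ≤ 1 := by omega
    have : d * g ≤ d * 1 := Nat.mul_le_mul_left d this
    omega
  have hdn : 2 * d ≤ n := by rw [hg, mul_comm 2 d]; exact Nat.mul_le_mul_left d hg2
  have hcmul : ∀ t i, G (i + d * t) = G i + t * c := by
    intro t
    induction t with
    | zero => simp
    | succ t ih => intro i; rw [mul_add_one, ← add_assoc, hc, ih]; push_cast; ring
  have hPn : P n = g * c := by
    have a := hGn 0
    have b := hcmul g 0
    rw [← hg] at b
    linarith
  have window : ∀ i m, m < d → G i + G m ≤ G (i + m) ∧ G (i + m) ≤ G i + G m + 1 := by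
    intro i m hm
    have hi := Nat.mod_add_div i d
    have hrd := Nat.mod_lt i hd0
    have a := hcmul (i / d) (i % d)
    have b := hcmul (i / d) (i % d + m)
    rw [hi] at a
    rw [show i % d + m + d * (i / d) = i + m by omega] at b
    generalize i % d = r at *
    rcases Nat.eq_zero_or_pos r with rfl | hr0
    · rw [zero_add] at b
      omega
    rcases Nat.eq_zero_or_pos m with rfl | hm0
    · simp [hG0]
    have e1 := hGs r hr0 (by omega)
    have e2 := hGs (r + m) (by omega) (by omega)
    have e3 := hGs m hm0 (by omega)
    have e4 := hGs d hd0 (by omega)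
    have e5 := hGs (m + d) (by omega) (by omega)
    have e6 := hc m
    -- The prefix of length m counts one more than G(m), which gives the lower bound; the window at
    -- d counts exactly G(m), which gives the upper one.
    have f1 := hl 0 r m le_rfl (by omega) (by omega) (by omega)
    have f2 := hl r d m (by omega) (by omega) (by omega) (by omega)
    rw [zero_add] at f1
    rw [add_comm d m] at f2
    have e7 := hc 0
    rw [zero_add] at e7
    omega
  refine ⟨d, g, c, hd0, hg2, by rw [hg, mul_comm], hPn, fun i hi hin => ?_⟩
  have := floor_of_almost_additive hd0 hG0 hc (fun i m hm => (window i m hm).1)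
    (fun i m hm => (window i m hm).2) i
  rwa [hGs i hi hin] at this

/-- If the prefix counts of a word are `0`, then the shifted roundings of a line of slope `c / d`
in lowest terms, then the value of the line at the length `g * d`, the word is minimally
unbalanced. -/
theorem minimally_unbalanced_of_floor {P : ℕ → ℤ} {d g : ℕ} {c : ℤ} (hd : 0 < d) (hg : 2 ≤ g)
    (hcop : IsCoprime (d : ℤ) c) (h0 : P 0 = 0) (hn : P (g * d) = g * c)
    (hP : ∀ i : ℕ, 0 < i → i < g * d →
      d * (P i - 1) ≤ i * c ∧ i * c < d * (P i - 1) + d) :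
    ¬ BalancedOn P 0 (g * d) ∧ BalancedOn P 1 (g * d) ∧ BalancedOn P 0 (g * d - 1) := by
  have hdg : 2 * d ≤ g * d := Nat.mul_le_mul_right d hg
  have hmul : ∀ t : ℕ, 0 < t → t < g → P (t * d) = t * c + 1 := by
    intro t ht htg
    obtain ⟨a, b⟩ := hP (t * d) (Nat.mul_pos ht hd) (Nat.mul_lt_mul_of_pos_right htg hd)
    have hd' : (0 : ℤ) < d := by exact_mod_cast hd
    push_cast at a b
    have a' : (d : ℤ) * (P (t * d) - 1) ≤ d * (t * c) := by linarith
    have b' : (d : ℤ) * (t * c) < d * (P (t * d) - 1 + 1) := by linarith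
    have := le_of_mul_le_mul_left a' hd'
    have := lt_of_mul_lt_mul_left b' hd'.le
    omega
  have hdvd : ∀ i : ℕ, (d : ℤ) * (P i - 1) = i * c → d ∣ i := by
    intro i hi
    have : (d : ℤ) ∣ i := hcop.dvd_of_dvd_mul_right ⟨_, hi.symm⟩
    exact_mod_cast this
  have hd' : (1 : ℤ) ≤ d := by exact_mod_cast hd
  have hg' : (2 : ℤ) ≤ g := by exact_mod_cast hg
  refine ⟨fun h => ?_, ?_, ?_⟩
  -- The prefix of length d has increment c + 1, the suffix of length d only c - 1.
  · have a := h 0 ((g - 1) * d) d le_rfl (Nat.zero_le _) (by omega)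
      (by rw [← add_one_mul, Nat.sub_add_cancel (by omega)])
    rw [← add_one_mul, Nat.sub_add_cancel (by omega), hmul (g - 1) (by omega) (by omega), hn,
      zero_add, h0] at a
    have b := hmul 1 one_pos (by omega)
    rw [one_mul] at b
    rw [b, Nat.cast_sub (by omega)] at a
    push_cast at a
    linarith
  -- The line ic/d + 1 + ((g-1)d - i)/(gd²): it meets the lattice at the last interior multiple of d
  -- and is just below gc + 1 at i = gd. The tilt is too small to affect other roundings.
  · refine balancedOn_of_line (N := g * d * d) (A := g * d * c - 1)
      (R := g * d * d + g * d - d) (by positivity) fun i hi hin => ?_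
    rcases hin.lt_or_eq with hin | rfl
    · obtain ⟨a, b⟩ := hP i hi hin
      have hi' : (1 : ℤ) ≤ i := by exact_mod_cast hi
      have hin' : (i : ℤ) < g * d := by exact_mod_cast hin
      have b' : (g * d : ℤ) * (i * c + 1) ≤ g * d * (d * (P i - 1) + d) :=
        mul_le_mul_of_nonneg_left (by linarith) (by positivity)
      refine ⟨?_, by linarith⟩
      rcases a.lt_or_eq with a | a
      · have a' : (g * d : ℤ) * (d * (P i - 1) + 1) ≤ g * d * (i * c) :=
          mul_le_mul_of_nonneg_left (by linarith) (by positivity)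
        nlinarith
      · obtain ⟨t, rfl⟩ := hdvd i a
        have : t + 1 ≤ g := by
          by_contra h'
          have : g * d ≤ t * d := Nat.mul_le_mul_right d (by omega)
          rw [mul_comm] at hin
          omega
        have : ((t : ℤ) + 1) * d ≤ g * d :=
          mul_le_mul_of_nonneg_right (by exact_mod_cast this) (by omega)
        have a' : (g * d : ℤ) * (d * (P (d * t) - 1)) = g * d * ((d * t : ℕ) * c) := by rw [a]
        push_cast at *
        linarith
    · rw [hn]
      push_cast
      have h1 : (d : ℤ) ≤ g * d * d := by nlinarith
      have h2 : (2 * d : ℤ) ≤ g * d := by nlinarith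
      constructor <;> nlinarith
  -- The opposite tilt, ic/d + 1 + (i - d)/(gd²): just below 1 at i = 0, on the lattice at i = d.
  · refine balancedOn_of_line (N := g * d * d) (A := g * d * c + 1)
      (R := g * d * d - d) (by positivity) fun i hi hin => ?_
    rcases Nat.eq_zero_or_pos i with rfl | hi
    · rw [h0]
      have h1 : (d : ℤ) ≤ g * d * d := by nlinarith
      constructor <;> push_cast <;> linarith
    · obtain ⟨a, b⟩ := hP i hi (by omega)
      have hin' : (i : ℤ) < g * d := by
        have : i < g * d := by omega
        exact_mod_cast this
      have b' : (g * d : ℤ) * (i * c + 1) ≤ g * d * (d * (P i - 1) + d) :=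
        mul_le_mul_of_nonneg_left (by linarith) (by positivity)
      refine ⟨?_, by linarith⟩
      rcases a.lt_or_eq with a | a
      · have a' : (g * d : ℤ) * (d * (P i - 1) + 1) ≤ g * d * (i * c) :=
          mul_le_mul_of_nonneg_left (by linarith) (by positivity)
        nlinarith
      · obtain ⟨t, rfl⟩ := hdvd i a
        have : 1 ≤ t := Nat.pos_of_mul_pos_left hi
        have : (d : ℤ) * 1 ≤ d * t :=
          mul_le_mul_of_nonneg_left (by exact_mod_cast this) (by omega)
        have a' : (g * d : ℤ) * (d * (P (d * t) - 1)) = g * d * ((d * t : ℕ) * c) := by rw [a]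
        push_cast at *
        linarith

/-! ### Words through their prefix counts -/

/-- The number of occurrences of the letter `b` in the prefix of length `i`. -/
def prefixCount (v : Word) (i : ℕ) : ℤ := (v.take i).count Letter.b

@[simp] theorem prefixCount_zero (v : Word) : prefixCount v 0 = 0 := by simp [prefixCount]

theorem prefixCount_length (v : Word) : prefixCount v v.length = v.count Letter.b := by
  simp [prefixCount]

theorem prefixCount_nonneg (v : Word) (i : ℕ) : 0 ≤ prefixCount v i := by simp [prefixCount]

theorem prefixCount_succ (v : Word) {i : ℕ} (hi : i < v.length) :
    prefixCount v (i + 1) = prefixCount v i + if v[i] = Letter.b then 1 else 0 := by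
  simp only [prefixCount, List.take_add_one, List.getElem?_eq_getElem hi, List.count_append]
  by_cases h : v[i] = Letter.b <;> simp [h]

theorem prefixCount_add (v : Word) (i m : ℕ) :
    prefixCount v (i + m) = prefixCount v i + ((v.drop i).take m).count Letter.b := by
  simp [prefixCount, List.take_add]

theorem count_a_add_count_b (v : Word) :
    v.count Letter.a + v.count Letter.b = v.length := by
  induction v with
  | nil => rfl
  | cons x v ih => cases x <;> simp <;> omega

theorem ext_prefixCount {u v : Word} (hl : u.length = v.length)
    (h : ∀ i, i ≤ u.length → prefixCount u i = prefixCount v i) : u = v := by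
  refine List.ext_getElem hl fun i h1 h2 => ?_
  have a := prefixCount_succ u h1
  have b := prefixCount_succ v h2
  rw [h i h1.le, h (i + 1) h1] at a
  cases hu : u[i] <;> cases hv : v[i] <;> simp_all

/-- For factors of equal length, differences in a's and in b's are opposite. -/
theorem isBalanced_iff (v : Word) :
    IsBalanced v ↔ BalancedOn (prefixCount v) 0 v.length := by
  constructor
  · intro h i j m _ _ hi hj
    have hlen : ∀ i, i + m ≤ v.length → ((v.drop i).take m).length = m := by
      intro i hi; simp; omega
    have inf : ∀ i, (v.drop i).take m <:+: v := fun i =>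
      (List.take_prefix _ _).isInfix.trans (List.drop_suffix _ _).isInfix
    have := h _ _ (inf i) (inf j) (by rw [hlen i hi, hlen j hj])
    have e1 := count_a_add_count_b ((v.drop i).take m)
    have e2 := count_a_add_count_b ((v.drop j).take m)
    rw [hlen i hi] at e1
    rw [hlen j hj] at e2
    rw [prefixCount_add, prefixCount_add]
    rw [abs_le] at this
    omega
  · intro h
    have main : ∀ u, u <:+: v → ∃ i, i + u.length ≤ v.length ∧
        prefixCount v (i + u.length) - prefixCount v i = u.count Letter.b := by
      rintro u ⟨s, t, rfl⟩
      refine ⟨s.length, by simp, ?_⟩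
      rw [prefixCount_add]
      simp
    intro u u' hu hu' hl
    obtain ⟨i, hi, ei⟩ := main u hu
    obtain ⟨j, hj, ej⟩ := main u' hu'
    rw [← hl] at hj ej
    have a := h i j u.length (Nat.zero_le _) (Nat.zero_le _) hi hj
    have b := h j i u.length (Nat.zero_le _) (Nat.zero_le _) hj hi
    have e1 := count_a_add_count_b u
    have e2 := count_a_add_count_b u'
    rw [abs_le]
    omega

theorem IsBalanced.of_isInfix {u v : Word} (hv : IsBalanced v) (h : u <:+: v) :
    IsBalanced u :=
  fun _ _ h1 h2 => hv _ _ (h1.trans h) (h2.trans h)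

/-- A proper factor misses the first or the last letter, and balance passes to factors. -/
theorem mem_minimalForbiddenWords_iff (v : Word) :
    v ∈ minimalForbiddenWords sturmianLanguage ↔
      ¬ IsBalanced v ∧ IsBalanced v.tail ∧ IsBalanced v.dropLast := by
  change (¬ IsBalanced v ∧ ∀ u : Word, u <:+: v → u ≠ v → IsBalanced u) ↔ _
  refine and_congr_right fun hv => ⟨fun h => ?_, ?_⟩
  · have hne : v ≠ [] := by
      rintro rfl
      refine hv fun u u' hu hu' _ => ?_
      simp [List.infix_nil.mp hu, List.infix_nil.mp hu']
    have hpos := List.length_pos_iff.mpr hne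
    refine ⟨h _ (List.tail_suffix v).isInfix fun e => ?_,
      h _ (List.dropLast_prefix v).isInfix fun e => ?_⟩
    · have := congrArg List.length e
      rw [List.length_tail] at this
      omega
    · have := congrArg List.length e
      rw [List.length_dropLast] at this
      omega
  · rintro ⟨h1, h2⟩ u ⟨s, t, rfl⟩ hne
    rcases s with _ | ⟨x, s⟩
    · have ht : t ≠ [] := by rintro rfl; simp at hne
      refine h2.of_isInfix ⟨[], t.dropLast, ?_⟩
      simp [List.dropLast_append_of_ne_nil ht]
    · exact h1.of_isInfix ⟨s, t, rfl⟩

theorem mem_minimalForbiddenWords_iff_balancedOn (v : Word) :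
    v ∈ minimalForbiddenWords sturmianLanguage ↔
      ¬ BalancedOn (prefixCount v) 0 v.length ∧ BalancedOn (prefixCount v) 1 v.length ∧
        BalancedOn (prefixCount v) 0 (v.length - 1) := by
  rw [mem_minimalForbiddenWords_iff, isBalanced_iff, isBalanced_iff, isBalanced_iff]
  refine and_congr_right fun _ => and_congr ?_ ?_
  · rcases v with _ | ⟨x, v⟩
    · constructor
      · intro _ i j m hi hj hie; simp at hie; omega
      · intro _ i j m hi hj hie hje
        simp only [List.tail_nil, List.length_nil] at hie hje
        obtain ⟨rfl, rfl, rfl⟩ : i = 0 ∧ j = 0 ∧ m = 0 := by omega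
        simp
    have key : ∀ i, prefixCount (x :: v) (i + 1) =
        prefixCount v i + if x = Letter.b then 1 else 0 := by
      intro i
      by_cases h : x = Letter.b <;> simp [prefixCount, h]
    simp only [List.tail_cons, List.length_cons]
    constructor
    · intro h i j m hi hj hie hje
      obtain ⟨i, rfl⟩ : ∃ t, i = t + 1 := ⟨i - 1, by omega⟩
      obtain ⟨j, rfl⟩ : ∃ t, j = t + 1 := ⟨j - 1, by omega⟩
      have := h i j m (Nat.zero_le _) (Nat.zero_le _) (by omega) (by omega)
      rw [add_right_comm i, add_right_comm j]
      simp only [key]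
      omega
    · intro h i j m _ _ hie hje
      have := h (i + 1) (j + 1) m (by omega) (by omega) (by omega) (by omega)
      rw [add_right_comm i, add_right_comm j] at this
      simp only [key] at this
      omega
  · have key : ∀ i, i ≤ v.length - 1 → prefixCount v.dropLast i = prefixCount v i := by
      intro i hi
      rw [prefixCount, prefixCount, List.dropLast_eq_take, List.take_take, min_eq_left hi]
    rw [List.length_dropLast]
    constructor <;> intro h i j m hi hj hie hje <;> have := h i j m hi hj hie hje
    · rwa [key _ hie, key _ hje, key i (by omega), key j (by omega)] at this
    · rwa [key _ hie, key _ hje, key i (by omega), key j (by omega)]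

/-! ### Exchanging the letters -/

/-- The exchange of the two letters. -/
def Letter.swap : Letter → Letter
  | .a => .b
  | .b => .a

@[simp] theorem Letter.swap_a : Letter.a.swap = .b := rfl

@[simp] theorem Letter.swap_b : Letter.b.swap = .a := rfl

@[simp] theorem Letter.swap_swap (x : Letter) : x.swap.swap = x := by cases x <;> rfl

/-- The word with the two letters exchanged. -/
def swapWord (v : Word) : Word := v.map Letter.swap

@[simp] theorem swapWord_swapWord (v : Word) : swapWord (swapWord v) = v := by
  simp [swapWord, Function.comp_def]

@[simp] theorem length_swapWord (v : Word) : (swapWord v).length = v.length := by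
  simp [swapWord]

theorem prefixCount_swapWord (v : Word) {i : ℕ} (hi : i ≤ v.length) :
    prefixCount (swapWord v) i = i - prefixCount v i := by
  have h : ∀ u : Word, (swapWord u).count Letter.b = u.count Letter.a := by
    intro u
    induction u with
    | nil => rfl
    | cons x u ih => cases x <;> simp_all [swapWord, Letter.swap,]
  have e := count_a_add_count_b (v.take i)
  have e' := h (v.take i)
  rw [List.length_take, min_eq_left hi] at e
  rw [swapWord, List.map_take] at e'
  rw [prefixCount, prefixCount, swapWord]
  omega

theorem swapWord_mem_minimalForbiddenWords {v : Word}
    (hv : v ∈ minimalForbiddenWords sturmianLanguage) :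
    swapWord v ∈ minimalForbiddenWords sturmianLanguage := by
  have key : ∀ (v : Word) (s e : ℕ), e ≤ v.length → BalancedOn (prefixCount v) s e →
      BalancedOn (prefixCount (swapWord v)) s e := by
    intro v s e he h i j m hi hj hie hje
    have := h j i m hj hi hje hie
    rw [prefixCount_swapWord v (by omega), prefixCount_swapWord v (by omega),
      prefixCount_swapWord v (by omega), prefixCount_swapWord v (by omega)]
    push_cast
    omega
  rw [mem_minimalForbiddenWords_iff_balancedOn] at hv ⊢
  rw [length_swapWord]
  refine ⟨fun h => hv.1 ?_, key _ _ _ le_rfl hv.2.1, key _ _ _ (Nat.sub_le _ _) hv.2.2⟩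
  simpa using key (swapWord v) _ _ (by simp) h

theorem IsPower.swapWord {v : Word} (hv : IsPower v) : IsPower (swapWord v) := by
  obtain ⟨u, k, hk, rfl⟩ := hv
  exact ⟨SturmianWords.swapWord u, k, hk, by simp [SturmianWords.swapWord, List.map_flatten]⟩

/-! ### Christoffel words as rounded lines -/

@[simp] theorem length_lowerChristoffel (p q : ℕ) : (lowerChristoffel p q).length = p + q := by
  simp [lowerChristoffel]

theorem upperChristoffel_eq_swapWord {p q : ℕ} (hp : 0 < p) (hq : 0 < q) :
    upperChristoffel p q = swapWord (lowerChristoffel q p) := by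
  refine List.ext_getElem (by simp [upperChristoffel, add_comm]) fun i h1 h2 => ?_
  have hne : (i + 1) * p % (p + q) ≠ i * p % (p + q) := by
    intro h
    have h' : (i * p + p) ≡ i * p + 0 [MOD p + q] := by rwa [add_one_mul] at h
    have := Nat.ModEq.add_left_cancel' _ h'
    rw [Nat.ModEq, Nat.mod_eq_of_lt (by omega), Nat.zero_mod] at this
    omega
  simp only [upperChristoffel, swapWord, lowerChristoffel, List.getElem_map, List.getElem_ofFn]
  rcases lt_or_gt_of_ne hne with h | h
  · have h' : ¬ (i + 1) * p % (q + p) > i * p % (q + p) := by rw [add_comm q p]; omega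
    rw [if_pos h, if_neg h', Letter.swap_b]
  · have h' : (i + 1) * p % (q + p) > i * p % (q + p) := by rwa [add_comm q p]
    rw [if_neg (by omega), if_pos h', Letter.swap_a]

/-- The residue of iq drops exactly when the quotient by p + q goes up by one, which is where b is
written. -/
theorem prefixCount_lowerChristoffel {p q : ℕ} (hp : 0 < p) (hq : 0 < q) {i : ℕ} (hi : i ≤ p + q) :
    prefixCount (lowerChristoffel p q) i = (i * q / (p + q) : ℕ) := by
  induction i with
  | zero => simp
  | succ i ih =>
    rw [prefixCount_succ _ (by simpa using hi), ih (by omega)]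
    simp only [lowerChristoffel, List.getElem_ofFn]
    have e1 := Nat.mod_add_div (i * q) (p + q)
    have e2 := Nat.mod_add_div ((i + 1) * q) (p + q)
    have l1 := Nat.mod_lt (i * q) (show 0 < p + q by omega)
    have l2 := Nat.mod_lt ((i + 1) * q) (show 0 < p + q by omega)
    have e3 : (i + 1) * q = i * q + q := add_one_mul i q
    have lo : i * q / (p + q) ≤ (i + 1) * q / (p + q) := Nat.div_le_div_right (by omega)
    have hi' : (i + 1) * q / (p + q) ≤ i * q / (p + q) + 1 := by
      rw [← Nat.add_div_right _ (show 0 < p + q by omega)]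
      exact Nat.div_le_div_right (by omega)
    rw [e3] at e2 l2 lo hi' ⊢
    rcases hi'.lt_or_eq with h | h
    · have h : (i * q + q) / (p + q) = i * q / (p + q) := by omega
      rw [h] at e2 ⊢
      have : (i * q + q) % (p + q) > i * q % (p + q) := by omega
      simp [this]
    · rw [h] at e2 ⊢
      rw [mul_add_one] at e2
      have : ¬ (i * q + q) % (p + q) > i * q % (p + q) := by omega
      simp [this]

/-- Scaling by g scales the residues, keeping their order, and they recur with period p + q. -/
theorem isPower_lowerChristoffel_mul {g : ℕ} (hg : 2 ≤ g) (p q : ℕ) :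
    IsPower (lowerChristoffel (g * p) (g * q)) := by
  refine ⟨lowerChristoffel p q, g, hg, ?_⟩
  have hmod : ∀ i j : ℕ, (i * (p + q) + j) * (g * q) % (g * p + g * q) =
      g * (j * q % (p + q)) := by
    intro i j
    rw [← mul_add, show (i * (p + q) + j) * (g * q) = g * (j * q + (p + q) * (i * q)) by ring,
      Nat.mul_mod_mul_left, Nat.add_mul_mod_self_left]
  have hlen : (lowerChristoffel (g * p) (g * q)) = List.ofFn fun i : Fin (g * (p + q)) =>
      if ((i : ℕ) + 1) * (g * q) % (g * p + g * q) > (i : ℕ) * (g * q) % (g * p + g * q)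
        then Letter.a else Letter.b :=
    List.ext_getElem (by simp [mul_add]) fun i h1 h2 => by simp [lowerChristoffel]
  rw [hlen, List.ofFn_mul, ← List.ofFn_const]
  congr 2
  funext i
  rw [lowerChristoffel]
  congr 1
  funext j
  have hgt : (g * ((j + 1) * q % (p + q)) > g * (j * q % (p + q))) ↔
      (j + 1) * q % (p + q) > j * q % (p + q) := Nat.mul_lt_mul_left (by omega)
  simp only [add_assoc, hmod, hgt]

/-! ### The two inclusions -/

theorem prefixCount_swap_ends (w : Word) {i : ℕ} (hi : 0 < i) (hi' : i < w.length + 2) :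
    prefixCount (Letter.b :: (w ++ [Letter.a])) i =
      prefixCount (Letter.a :: (w ++ [Letter.b])) i + 1 := by
  obtain ⟨i, rfl⟩ : ∃ t, i = t + 1 := ⟨i - 1, by omega⟩
  have : i - w.length = 0 := by omega
  simp [prefixCount, List.take_append, this]

theorem count_flatten_replicate (u : Word) (k : ℕ) (x : Letter) :
    (List.replicate k u).flatten.count x = k * u.count x := by
  induction k with
  | zero => simp
  | succ k ih => simp [List.replicate_succ, ih, add_one_mul, add_comm]

theorem mem_minimalForbiddenWords_of_lowerChristoffel {p q : ℕ} (hp : 0 < p) (hq : 0 < q)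
    {w : Word} (h : Letter.a :: (w ++ [Letter.b]) = lowerChristoffel p q)
    (hpow : IsPower (lowerChristoffel p q)) :
    Letter.b :: (w ++ [Letter.a]) ∈ minimalForbiddenWords sturmianLanguage := by
  have hlen : w.length + 2 = p + q := by
    have := congrArg List.length h
    simpa [add_assoc] using this
  have hcount : (lowerChristoffel p q).count Letter.b = q := by
    have := prefixCount_length (lowerChristoffel p q)
    rw [length_lowerChristoffel, prefixCount_lowerChristoffel hp hq le_rfl,
      Nat.mul_div_cancel_left _ (by omega)] at this
    exact_mod_cast this.symm
  obtain ⟨u, k, hk, hu⟩ := hpow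
  have hkn : k ∣ p + q := by
    rw [← length_lowerChristoffel p q, hu]
    simp
  have hkq : k ∣ q := by
    rw [← hcount, hu, count_flatten_replicate]
    exact dvd_mul_right _ _
  obtain ⟨g, d, c, hg0, hcop, hn, hqc⟩ := Nat.exists_coprime' (m := p + q) (n := q)
    (Nat.gcd_pos_of_pos_right _ hq)
  rw [mul_comm] at hn hqc
  subst hqc
  -- The exponent k divides both the length and the number of b's, hence their gcd g.
  have hg : 2 ≤ g := by
    have h1 : k ∣ (p + g * c).gcd (g * c) := Nat.dvd_gcd hkn hkq
    rw [hn, Nat.gcd_mul_left, hcop.gcd_eq_one, mul_one] at h1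
    exact hk.trans (Nat.le_of_dvd hg0 h1)
  have hd : 0 < d := Nat.pos_of_ne_zero (by rintro rfl; omega)
  rw [mem_minimalForbiddenWords_iff_balancedOn]
  have hl : (Letter.b :: (w ++ [Letter.a])).length = g * d := by
    rw [← hn, ← hlen]; simp
  rw [hl]
  refine minimally_unbalanced_of_floor (c := c) hd hg (Nat.isCoprime_iff_coprime.mpr hcop)
    (prefixCount_zero _) ?_ fun i hi hin => ?_
  · rw [← hl, prefixCount_length]
    have : (Letter.b :: (w ++ [Letter.a])).count Letter.b = g * c := by
      rw [← hcount, ← h]; simp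
    exact_mod_cast this
  · rw [prefixCount_swap_ends w hi (by omega), h, prefixCount_lowerChristoffel hp hq (by omega), hn]
    rw [mul_left_comm i, Nat.mul_div_mul_left _ _ hg0, add_sub_cancel_right]
    have e1 := Nat.div_mul_le_self (i * c) d
    have e2 := Nat.lt_div_mul_add (a := i * c) hd
    rw [mul_comm (i * c / d)] at e1 e2
    exact ⟨by exact_mod_cast e1, by exact_mod_cast e2⟩

theorem exists_lowerChristoffel_of_mem_minimalForbiddenWords {v : Word} {k : ℕ}
    (hv : v ∈ minimalForbiddenWords sturmianLanguage) (hk : 0 < k) (hkn : k < v.length)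
    (h : 2 ≤ prefixCount v k - (prefixCount v v.length - prefixCount v (v.length - k))) :
    ∃ (p q : ℕ) (w : Word), 0 < p ∧ 0 < q ∧
      Letter.a :: (w ++ [Letter.b]) = lowerChristoffel p q ∧ IsPower (lowerChristoffel p q) ∧
      v = Letter.b :: (w ++ [Letter.a]) := by
  rw [mem_minimalForbiddenWords_iff_balancedOn] at hv
  obtain ⟨d, g, c, hd, hg, hn, hc, hfl⟩ := floor_of_minimally_unbalanced (prefixCount_zero v)
    (fun i hi => by rw [prefixCount_succ v hi]; split_ifs <;> omega) hv.2.1 hv.2.2 hk hkn h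
  have hd' : (0 : ℤ) < d := by exact_mod_cast hd
  have hg' : (0 : ℤ) < g := by exact_mod_cast (by omega : 0 < g)
  have hc0 : 0 ≤ c := by
    have := prefixCount_nonneg v v.length
    rw [hc] at this
    exact nonneg_of_mul_nonneg_right this hg'
  lift c to ℕ using hc0
  obtain ⟨x, t, rfl⟩ : ∃ x t, v = x :: t := List.exists_cons_of_length_pos (by omega)
  obtain ⟨w, y, rfl⟩ : ∃ w y, t = w ++ [y] := by
    rcases List.eq_nil_or_concat t with rfl | ⟨w, y, rfl⟩
    · simp at hkn; omega
    · exact ⟨w, y, by simp⟩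
  have hlen : (x :: (w ++ [y])).length = w.length + 2 := by simp
  rw [hlen] at hn hc hkn
  simp only [hlen] at hfl
  obtain ⟨a1, b1⟩ := hfl 1 one_pos (by omega)
  have hx : x = Letter.b := by
    cases x with
    | b => rfl
    | a =>
      have : prefixCount (Letter.a :: (w ++ [y])) 1 = 0 := by simp [prefixCount]
      rw [this] at b1
      push_cast at b1
      omega
  subst hx
  have h1 : prefixCount (Letter.b :: (w ++ [y])) 1 = 1 := by simp [prefixCount]
  rw [h1] at a1 b1
  have hcd : c < d := by push_cast at b1; omega
  have hc1 : 0 < c := by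
    rcases Nat.eq_zero_or_pos c with rfl | h'
    · have := prefixCount_length (Letter.b :: (w ++ [y]))
      rw [hlen, hc] at this
      simp at this
      omega
    · exact h'
  obtain ⟨a2, b2⟩ := hfl (w.length + 1) (by omega) (by omega)
  have hs := prefixCount_succ (Letter.b :: (w ++ [y])) (i := w.length + 1) (by simp)
  -- A final b would give P(n - 1) = gc - 1, and the bound there would force d < c.
  have hy : y = Letter.a := by
    cases y with
    | a => rfl
    | b =>
      rw [hc] at hs
      have hs' : prefixCount (Letter.b :: (w ++ [Letter.b])) (w.length + 1) = g * c - 1 := by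
        simp at hs
        linarith
      rw [hs'] at b2
      have : ((w.length + 1 : ℕ) : ℤ) = g * d - 1 := by
        have : ((w.length + 2 : ℕ) : ℤ) = g * d := by exact_mod_cast hn
        push_cast at *
        linarith
      rw [this] at b2
      have : (c : ℤ) < d := by exact_mod_cast hcd
      nlinarith
  subst hy
  have hgd : g * (d - c) + g * c = g * d := by rw [← mul_add, Nat.sub_add_cancel hcd.le]
  have hgp : 0 < g * (d - c) := Nat.mul_pos (by omega) (by omega)
  have hgq : 0 < g * c := Nat.mul_pos (by omega) hc1
  refine ⟨g * (d - c), g * c, w, hgp, hgq, ?_,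
    isPower_lowerChristoffel_mul hg _ _, rfl⟩
  refine ext_prefixCount (by simp; omega) fun i hi => ?_
  have hl' : (Letter.a :: (w ++ [Letter.b])).length = w.length + 2 := by simp
  rw [hl'] at hi
  rw [prefixCount_lowerChristoffel hgp hgq (by omega), hgd, mul_left_comm,
    Nat.mul_div_mul_left _ _ (by omega)]
  rcases Nat.eq_zero_or_pos i with rfl | hi0
  · simp
  rcases hi.lt_or_eq with hi | rfl
  · have hsw := prefixCount_swap_ends w hi0 hi
    obtain ⟨a3, b3⟩ := hfl i hi0 hi
    have hnn := prefixCount_nonneg (Letter.a :: (w ++ [Letter.b])) i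
    rw [hsw, add_sub_cancel_right] at a3 b3
    generalize prefixCount (Letter.a :: (w ++ [Letter.b])) i = r at *
    lift r to ℕ using hnn
    rw [Nat.cast_inj, eq_comm]
    have a4 : d * r ≤ i * c := by exact_mod_cast a3
    have b4 : i * c < d * r + d := by exact_mod_cast b3
    exact Nat.div_eq_of_lt_le (by linarith) (by linarith)
  · have e1 := prefixCount_length (Letter.a :: (w ++ [Letter.b]))
    have e2 := prefixCount_length (Letter.b :: (w ++ [Letter.a]))
    have e3 : (Letter.b :: (w ++ [Letter.a])).count Letter.b =
        (Letter.a :: (w ++ [Letter.b])).count Letter.b := by simp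
    rw [hlen, e3, ← e1, hl', hc] at e2
    rw [← e2, hn, mul_right_comm, Nat.mul_div_cancel _ hd]
    push_cast
    rfl

/-- The two unbalanced factors of a minimal forbidden word are a prefix and a suffix. -/
theorem exists_prefix_suffix_of_mem_minimalForbiddenWords {v : Word}
    (hv : v ∈ minimalForbiddenWords sturmianLanguage) :
    ∃ k, 0 < k ∧ k < v.length ∧
      (2 ≤ prefixCount v k - (prefixCount v v.length - prefixCount v (v.length - k)) ∨
        2 ≤ prefixCount v v.length - prefixCount v (v.length - k) - prefixCount v k) := by
  rw [mem_minimalForbiddenWords_iff_balancedOn] at hv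
  obtain ⟨h, hr, hl⟩ := hv
  simp only [BalancedOn, not_forall, not_le] at h
  obtain ⟨i, j, m, -, -, hi, hj, h⟩ := h
  have hm : m ≠ 0 := by rintro rfl; simp at h
  have hij : i ≠ j := by rintro rfl; omega
  have c1 : i = 0 ∨ j = 0 := by
    by_contra h'
    have := hr i j m (by omega) (by omega) hi hj
    omega
  have c2 : i + m = v.length ∨ j + m = v.length := by
    by_contra h'
    have := hl i j m (by omega) (by omega) (by omega) (by omega)
    omega
  refine ⟨m, by omega, by omega, ?_⟩
  rcases c1 with rfl | rfl
  · left
    have e : j = v.length - m := by omega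
    rw [Nat.zero_add, prefixCount_zero, show j + m = v.length by omega, e] at h
    omega
  · right
    have e : i = v.length - m := by omega
    rw [Nat.zero_add, prefixCount_zero, show i + m = v.length by omega, e] at h
    omega

/-- The minimal forbidden words for the finite Sturmian words are the words `ywx` for which `xwy`
is a non-primitive Christoffel word. -/
theorem minimalForbiddenWords_sturmianLanguage :
    minimalForbiddenWords sturmianLanguage =
      {v : Word | ∃ (x y : Letter) (w : Word),
        x ≠ y ∧
        IsChristoffel ([x] ++ w ++ [y]) ∧
        ¬ IsPrimitive ([x] ++ w ++ [y]) ∧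
        v = [y] ++ w ++ [x]} := by
  ext v
  simp only [IsPrimitive, not_not, List.cons_append, List.nil_append]
  constructor
  · intro hv
    obtain ⟨k, hk, hkn, h | h⟩ := exists_prefix_suffix_of_mem_minimalForbiddenWords hv
    · obtain ⟨p, q, w, hp, hq, hw, hpow, rfl⟩ :=
        exists_lowerChristoffel_of_mem_minimalForbiddenWords hv hk hkn h
      exact ⟨Letter.a, Letter.b, w, by decide, ⟨p, q, hp, hq, Or.inl hw⟩, hw ▸ hpow, rfl⟩
    · obtain ⟨p, q, w, hp, hq, hw, hpow, hvw⟩ :=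
        exists_lowerChristoffel_of_mem_minimalForbiddenWords
          (swapWord_mem_minimalForbiddenWords hv) hk (by simpa using hkn) (by
            rw [length_swapWord, prefixCount_swapWord v hkn.le, prefixCount_swapWord v le_rfl,
              prefixCount_swapWord v (Nat.sub_le _ _)]
            omega)
      have hw' : Letter.b :: (swapWord w ++ [Letter.a]) = swapWord (lowerChristoffel p q) := by
        rw [← hw]; simp [swapWord]
      refine ⟨Letter.b, Letter.a, swapWord w, by decide,
        ⟨q, p, hq, hp, Or.inr ?_⟩, hw' ▸ hpow.swapWord, ?_⟩
      · rw [hw', upperChristoffel_eq_swapWord hq hp]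
      · rw [← swapWord_swapWord v, hvw]; simp [swapWord]
  · rintro ⟨x, y, w, hxy, ⟨p, q, hp, hq, h⟩, hpow, rfl⟩
    have first : ∀ {p q : ℕ} {x : Letter} {t : Word}, 0 < p → 0 < q →
        x :: t = lowerChristoffel p q → x = Letter.a := by
      intro p q x t hp hq h
      have e := prefixCount_lowerChristoffel hp hq (i := 1) (by omega)
      rw [← h, Nat.div_eq_of_lt (by omega)] at e
      cases x with
      | a => rfl
      | b => simp [prefixCount] at e
    rcases h with h | h
    · obtain rfl := first hp hq h
      obtain rfl : y = Letter.b := by cases y <;> simp_all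
      exact mem_minimalForbiddenWords_of_lowerChristoffel hp hq h (h ▸ hpow)
    · rw [upperChristoffel_eq_swapWord hp hq] at h
      have h' : x.swap :: (swapWord w ++ [y.swap]) = lowerChristoffel q p := by
        rw [← swapWord_swapWord (lowerChristoffel q p), ← h]; simp [swapWord]
      have hx := first hq hp h'
      obtain rfl : x = Letter.b := by cases x <;> simp_all [Letter.swap]
      obtain rfl : y = Letter.a := by cases y <;> simp_all
      have hpow' : IsPower (lowerChristoffel q p) := by
        rw [← swapWord_swapWord (lowerChristoffel q p), ← h]
        exact hpow.swapWord
      have := swapWord_mem_minimalForbiddenWords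
        (mem_minimalForbiddenWords_of_lowerChristoffel hq hp h' hpow')
      simpa [swapWord, Function.comp_def] using this

end SturmianWords

theorem mainTheorem4 :
    SturmianWords.minimalForbiddenWords SturmianWords.sturmianLanguage =
      {v : SturmianWords.Word | ∃ (x y : SturmianWords.Letter) (w : SturmianWords.Word),
        x ≠ y ∧
        SturmianWords.IsChristoffel ([x] ++ w ++ [y]) ∧
        ¬ SturmianWords.IsPrimitive ([x] ++ w ++ [y]) ∧
        v = [y] ++ w ++ [x]} :=
  SturmianWords.minimalForbiddenWords_sturmianLanguage
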